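/- \textbf{Setting.} There are $n$ men $M$ and $n$ women $W$; each agent has a preference list, i.e. a strict total order on the agents of the other side; $\succ$ denotes the true preferences, and $\mathrm{DA}(\mathbf p)$ is the matching produced by the men-proposing deferred acceptance algorithm on the lists $\mathbf p$. In the \emph{woman self-manipulation game} with strategic women $P_w\subseteq W$, every woman in $P_w$ reports an arbitrary preference list and all other agents report truthfully. A strategy profile $\mathbf p$ is a \emph{Nash equilibrium} if no woman $w\in P_w$ has a list $\mathbf p'_w$ such that she strictly prefers, according to her true list $\succ_w$, her partner in $\mathrm{DA}(\mathbf p_{-w},\mathbf p'_w)$ to her partner in $\mathrm{DA}(\mathbf p)$. A list $\mathbf p'_w$ is \emph{inconspicuous} to $\mathbf p_w$ if it is obtained from $\mathbf p_w$ by promoting at most one man and making no other changes. An \emph{optimal inconspicuous self-manipulation} of $w$ in the instance $\langle M,W,\mathbf p\rangle$ is a list $\mathbf p'_w$, inconspicuous to $\mathbf p_w$, that gives her a partner in $\mathrm{DA}(\mathbf p_{-w},\mathbf p'_w)$ whom she strictly prefers, according to $\mathbf p_w$, to her partner in $\mathrm{DA}(\mathbf p)$, and that gives her, according to $\mathbf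 p_w$, the best partner among all such lists. An \emph{inconspicuous dynamics} is a sequence $\mathbf p^{(1)},\mathbf p^{(2)},\dots$ of profiles with $\mathbf p^{(1)}=\succ$ such that $\mathbf p^{(t+1)}$ results from $\mathbf p^{(t)}$ by an optimal inconspicuous self-manipulation of some $w\in P_w$ in $\langle M,W,\mathbf p^{(t)}\rangle$ if one exists, and $\mathbf p^{(t+1)}=\mathbf p^{(t)}$ otherwise. \textbf{Theorem} (NE of the woman self-manipulation game). For every instance $\langle M,W,\succ\rangle$ and all $P_w\subseteq W$, every inconspicuous dynamics reaches a fixed point after at most $n^2$ steps (it is constant from then on), and this fixed point is a Nash equilibrium. Moreover, the dynamics can be carried out in polynomial time: there is a polynomial $q$ such that, for every $n$, every instance and every $P_w$, the algorithm that performs $n^2$ steps of the dynamics, each by running deferred acceptance on all profiles in which one woman promotes one man and then choosing a best beneficial promotion of a strategic woman (if there is one), uses at most $q(n)$ elementary operations and outputs the fixed point of an inconspicuous dynamics. -/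

import Mathlib

/-! ### Markets and preference lists

There are `n` men and `n` women, both labelled by `Fin n`. -/

namespace WomanManipulation

/-- A man of a market of size `n`. -/
abbrev Man (n : ℕ) := Fin n

/-- A woman of a market of size `n`. -/
abbrev Woman (n : ℕ) := Fin n

/-- A preference list over the `n` agents of the other side, i.e. a strict total order on them:
`L k` is the agent in position `k`, and position `0` is the most preferred one. -/
abbrev PrefList (n : ℕ) := Fin n ≃ Fin n

/-- An agent with preference list `L` strictly prefers `x` to `y`. -/
def Prefers {n : ℕ} (L : PrefList n) (x y : Fin n) : Prop := L.symm x < L.symm y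

instance {n : ℕ} (L : PrefList n) (x y : Fin n) : Decidable (Prefers L x y) :=
  inferInstanceAs (Decidable (L.symm x < L.symm y))

/-- The preference lists of all women. -/
abbrev WomenProfile (n : ℕ) := Woman n → PrefList n

/-- A stable matching instance: the preference lists of all men and of all women. -/
structure Market (n : ℕ) where
  men : Man n → PrefList n
  women : WomenProfile n

/-- A (perfect) matching, as the bijection from men to their partners; the partner of a woman `w`
is `μ.symm w`. -/
abbrev Matching (n : ℕ) := Man n ≃ Woman n

/-! ### The (men-proposing) deferred acceptance algorithm

As men propose down their lists, the state of the algorithm is the number `k m` of rejections that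
each man `m` has received so far: the women who have rejected him are the first `k m` women of his
list, and his standing proposal is to the next one. In a round, every man without a standing
proposal proposes to his favourite woman who has not rejected him yet, and then every woman keeps
the favourite one of the men who propose to her, and rejects all others. -/

namespace DA

/-- The woman to whom `m` currently proposes: his favourite among those who have not rejected him
(`none` if all have). -/
def target {n : ℕ} (men : Man n → PrefList n) (k : Man n → ℕ) (m : Man n) : Option (Woman n) :=
  if h : k m < n then some (men m ⟨k m, h⟩) else none

/-- `m` is rejected: the woman to whom he proposes has a proposal of a man she prefers. -/
def Rejected {n : ℕ} (I : Market n) (k : Man n → ℕ) (m : Man n) : Prop :=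
  ∃ w, target I.men k m = some w ∧ ∃ m', target I.men k m' = some w ∧ Prefers (I.women w) m' m

instance {n : ℕ} (I : Market n) (k : Man n → ℕ) (m : Man n) : Decidable (Rejected I k m) :=
  inferInstanceAs (Decidable (∃ _, _ ∧ ∃ _, _ ∧ _))

/-- One round of proposals and rejections. -/
def round {n : ℕ} (I : Market n) (k : Man n → ℕ) : Man n → ℕ :=
  fun m => if Rejected I k m then k m + 1 else k m

/-- The state after `t` rounds; initially, nobody has been rejected. -/
def state {n : ℕ} (I : Market n) : ℕ → Man n → ℕ
  | 0 => fun _ => 0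
  | t + 1 => round I (state I t)

/-- Every woman who has rejected some man has a standing proposal. -/
theorem exists_suitor {n : ℕ} (I : Market n) (t : ℕ) (m : Man n) (i : Fin n)
    (hi : (i : ℕ) < state I t m) : ∃ m', target I.men (state I t) m' = some (I.men m i) := by
  induction t with
  | zero => simp [state] at hi
  | succ t ih =>
    -- some man proposes to the woman in round `t`
    have h1 : ∃ m', target I.men (state I t) m' = some (I.men m i) := by
      by_cases hlt : (i : ℕ) < state I t m
      · exact ih hlt
      · have hr : Rejected I (state I t) m ∧ (i : ℕ) = state I t m := by
          simp only [state, round] at hi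
          split_ifs at hi with h
          · exact ⟨h, by omega⟩
          · omega
        refine ⟨m, ?_⟩
        have : state I t m < n := hr.2 ▸ i.2
        simp only [target, this, dif_pos, Option.some.injEq]
        congr 1
        ext
        exact hr.2.symm
    -- her favourite suitor is not rejected
    classical
    let S := Finset.univ.filter fun m' => target I.men (state I t) m' = some (I.men m i)
    obtain ⟨b, hbS, hb⟩ := S.exists_min_image (fun m' => (I.women (I.men m i)).symm m')
      ⟨h1.choose, by simp [S, h1.choose_spec]⟩
    have hbt : target I.men (state I t) b = some (I.men m i) := by simpa [S] using hbS
    have hnr : ¬ Rejected I (state I t) b := by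
      rintro ⟨w, hw, m', hm', hp⟩
      rw [hbt, Option.some.injEq] at hw
      subst hw
      exact absurd hp (not_lt.2 (hb m' (by simp [S, hm'])))
    refine ⟨b, ?_⟩
    have : state I (t + 1) b = state I t b := by simp [state, round, hnr]
    simpa [target, this] using hbt

/-- A man is never rejected by all women. -/
theorem state_lt {n : ℕ} (I : Market n) (t : ℕ) (m : Man n) : state I t m < n := by
  by_contra hm
  have hs : ∀ w : Woman n, ∃ m', target I.men (state I t) m' = some w := fun w => by
    obtain ⟨m', hm'⟩ := exists_suitor I t m ((I.men m).symm w)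
      (lt_of_lt_of_le (Fin.is_lt _) (not_lt.1 hm))
    exact ⟨m', by simpa using hm'⟩
  choose f hf using hs
  have hinj : Function.Injective f := fun a b hab => by
    have := hf a
    rw [hab, hf b] at this
    exact (Option.some.inj this).symm
  obtain ⟨w, hw⟩ := (Finite.injective_iff_surjective.1 hinj) m
  have := hf w
  rw [hw, target, dif_neg hm] at this
  exact absurd this (by simp)

/-- The algorithm terminates: no man is rejected after `n ^ 2` rounds. -/
theorem not_rejected {n : ℕ} (I : Market n) (m : Man n) :
    ¬ Rejected I (state I (n ^ 2)) m := by
  have hfix : ∀ t, (∀ m, ¬ Rejected I (state I t) m) → state I (t + 1) = state I t :=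
    fun t h => funext fun m => by simp [state, round, h m]
  have key : ∀ t, (∀ m, ¬ Rejected I (state I t) m) ∨ t ≤ ∑ m, state I t m := by
    intro t
    induction t with
    | zero => exact Or.inr (Nat.zero_le _)
    | succ t ih =>
      by_cases h : ∀ m, ¬ Rejected I (state I t) m
      · left
        rw [hfix t h]
        exact h
      · right
        have ih' := ih.resolve_left h
        push Not at h
        obtain ⟨m₀, hm₀⟩ := h
        have : ∑ m, state I t m < ∑ m, state I (t + 1) m := by
          refine Finset.sum_lt_sum (fun m _ => ?_) ⟨m₀, Finset.mem_univ _, ?_⟩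
          · simp only [state, round]
            split_ifs <;> omega
          · simp [state, round, hm₀]
        omega
  rcases key (n ^ 2) with h | h
  · exact h m
  · exfalso
    have hlt : ∑ m, state I (n ^ 2) m < ∑ _m : Man n, n :=
      Finset.sum_lt_sum_of_nonempty ⟨m, Finset.mem_univ _⟩ fun m _ => state_lt I _ m
    simp only [Finset.sum_const, Finset.card_univ, Fintype.card_fin, smul_eq_mul] at hlt
    nlinarith

/-- The woman to whom a man is matched when the algorithm stops. -/
def partner {n : ℕ} (I : Market n) (m : Man n) : Woman n :=
  I.men m ⟨state I (n ^ 2) m, state_lt I _ m⟩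

theorem partner_injective {n : ℕ} (I : Market n) : Function.Injective (partner I) := by
  intro a b hab
  by_contra hne
  have ht : ∀ m, target I.men (state I (n ^ 2)) m = some (partner I m) := fun m => by
    simp [target, state_lt, partner]
  rcases lt_or_gt_of_ne ((I.women (partner I a)).symm.injective.ne hne) with h | h
  · exact not_rejected I b ⟨_, hab ▸ ht b, a, ht a, h⟩
  · exact not_rejected I a ⟨_, ht a, b, hab ▸ ht b, h⟩

end DA

/-- The outcome of the deferred acceptance algorithm. -/
noncomputable def deferredAcceptance {n : ℕ} (I : Market n) : Matching n :=
  Equiv.ofBijective (DA.partner I) (Finite.injective_iff_bijective.1 (DA.partner_injective I))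

/-! ### The woman self-manipulation game

The men always report their lists `I.men`. A strategy profile is represented by the lists `p` that
all women report, where the non-strategic women are to report truthfully. -/

/-- The man that `w` gets from deferred acceptance if the women report `p`. -/
noncomputable def outcome {n : ℕ} (men : Man n → PrefList n) (p : WomenProfile n) (w : Woman n) :
    Man n :=
  (deferredAcceptance ⟨men, p⟩).symm w

/-- At the profile `p`, a woman `w` whose preferences are given by `L₀` benefits from reporting `L`
instead of `p w`. -/
def IsSelfManipulation {n : ℕ} (men : Man n → PrefList n) (L₀ : PrefList n) (p : WomenProfile n)
    (w : Woman n) (L : PrefList n) : Prop :=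
  Prefers L₀ (outcome men (Function.update p w L) w) (outcome men p w)

/-- `p` is a Nash equilibrium of the game on `I` with strategic women `Pw`: it is a strategy profile
of the game (the other women are truthful), and no strategic woman can self-manipulate at `p` with
respect to her true preferences. -/
def IsNashEquilibrium {n : ℕ} (I : Market n) (Pw : Finset (Woman n)) (p : WomenProfile n) : Prop :=
  (∀ w ∉ Pw, p w = I.women w) ∧
    ∀ w ∈ Pw, ∀ L : PrefList n, ¬ IsSelfManipulation I.men (I.women w) p w L

/-- `L'` is inconspicuous to `L`: it is obtained from `L` by promoting at most one man `d` and
making no other changes. -/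
def IsInconspicuous {n : ℕ} (L L' : PrefList n) : Prop :=
  ∃ d : Man n, (∀ x y, x ≠ d → y ≠ d → (Prefers L' x y ↔ Prefers L x y)) ∧
    ∀ x, Prefers L d x → Prefers L' d x

/-- Reporting `L` is an optimal inconspicuous self-manipulation by `w` in the instance in which the
preference lists are `men` and `p`: among the inconspicuous self-manipulations by `w` in this
instance, none gives her a better partner. -/
def IsOptimalInconspicuous {n : ℕ} (men : Man n → PrefList n) (p : WomenProfile n) (w : Woman n)
    (L : PrefList n) : Prop :=
  IsInconspicuous (p w) L ∧ IsSelfManipulation men (p w) p w L ∧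
    ∀ L', IsInconspicuous (p w) L' → IsSelfManipulation men (p w) p w L' →
      ¬ Prefers (p w) (outcome men (Function.update p w L') w)
        (outcome men (Function.update p w L) w)

/-- `q` results from `p` by an optimal inconspicuous self-manipulation by a strategic woman in the
instance in which the preference lists are `men` and `p`. -/
def IsManipulationStep {n : ℕ} (men : Man n → PrefList n) (Pw : Finset (Woman n))
    (p q : WomenProfile n) : Prop :=
  ∃ w ∈ Pw, ∃ L, IsOptimalInconspicuous men p w L ∧ q = Function.update p w L

/-- `p 0, p 1, …` is an inconspicuous dynamics for the strategic women `Pw`: it starts at the true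
preferences, each profile results from its predecessor by an optimal inconspicuous
self-manipulation by some strategic woman if there is one, and equals its predecessor otherwise. -/
def IsInconspicuousDynamics {n : ℕ} (I : Market n) (Pw : Finset (Woman n))
    (p : ℕ → WomenProfile n) : Prop :=
  p 0 = I.women ∧ ∀ t, IsManipulationStep I.men Pw (p t) (p (t + 1)) ∨
    ((¬ ∃ q, IsManipulationStep I.men Pw (p t) q) ∧ p (t + 1) = p t)

/-! ### Computations with a count of elementary operations

A computation carries its result and the number of elementary operations that it performs.
Elementary operations are: reading or writing an entry of a table, counting up by one, comparing
two numbers, and testing whether a woman is strategic. A preference list is stored by two tables,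
the agent in each position and the position of each agent. -/

/-- A result with the number of elementary operations used to obtain it. -/
structure Timed (α : Type) where
  val : α
  cost : ℕ

namespace Timed

/-- A result that is obtained with `c` elementary operations. -/
def ops {α : Type} (c : ℕ) (a : α) : Timed α := ⟨a, c⟩

/-- First `x`, then `f` on the result of `x`. -/
def bind {α β : Type} (x : Timed α) (f : α → Timed β) : Timed β :=
  ⟨(f x.val).val, x.cost + (f x.val).cost⟩

instance : Monad Timed where
  pure := ops 0
  bind := bind

/-- A loop over `Fin n` that stores the result of the `i`th pass in entry `i` of a table. -/
def table {n : ℕ} {α : Type} (f : Fin n → Timed α) : Timed (Fin n → α) :=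
  ⟨fun i => (f i).val, 1 + ∑ i, ((f i).cost + 2)⟩

/-- A loop over `Fin n` that returns the first `some` that a pass yields. -/
def first {n : ℕ} {α : Type} (f : Fin n → Timed (Option α)) : Timed (Option α) :=
  ⟨(List.finRange n).findSome? fun i => (f i).val, 1 + ∑ i, ((f i).cost + 2)⟩

/-- A loop over `Fin n` that tests whether some pass yields `true`. -/
def any {n : ℕ} (f : Fin n → Timed Bool) : Timed Bool :=
  ⟨decide (∃ i, (f i).val = true), 1 + ∑ i, ((f i).cost + 2)⟩

/-- `t` passes of the loop body `f`, starting from `a`. -/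
def iterate {α : Type} (f : α → Timed α) : ℕ → α → Timed α
  | 0, a => ops 1 a
  | t + 1, a => do
    let b ← iterate f t a
    let c ← f b
    ops 2 c

end Timed

namespace Algorithm

open Timed

/-- The woman to whom `m` currently proposes: read `k m`, compare it with `n`, read the list. -/
def target {n : ℕ} (men : Man n → PrefList n) (k : Man n → ℕ) (m : Man n) :
    Timed (Option (Woman n)) :=
  ops 3 (DA.target men k m)

/-- Read the positions of `x` and `y` in the list `L` and compare them. -/
def prefers {n : ℕ} (L : PrefList n) (x y : Fin n) : Timed Bool :=
  ops 3 (decide (Prefers L x y))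

/-- Decide whether `m` is rejected, by a loop over his potential rivals. -/
def rejected {n : ℕ} (I : Market n) (k : Man n → ℕ) (m : Man n) : Timed Bool := do
  let x ← target I.men k m
  match x with
  | none => ops 1 false
  | some w => any fun m' => do
    let y ← target I.men k m'
    let same ← ops 1 (decide (y = some w))
    if same then prefers (I.women w) m' m else ops 1 false

/-- One round of deferred acceptance. -/
def round {n : ℕ} (I : Market n) (k : Man n → ℕ) : Timed (Man n → ℕ) :=
  table fun m => do
    let r ← rejected I k m
    if r then ops 3 (k m + 1) else ops 2 (k m)

/-- Run `n ^ 2` rounds of deferred acceptance, find the man who is matched to `w`, and return his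
position in the list `L` (or `n`, if there is no such man). -/
def outcomeRank {n : ℕ} (I : Market n) (L : PrefList n) (w : Woman n) : Timed ℕ := do
  let k₀ ← table fun _ => ops 1 0
  let k ← iterate (round I) (n ^ 2) k₀
  let r ← first fun m => do
    let x ← target I.men k m
    if x = some w then ops 2 (some (L.symm m : ℕ)) else ops 1 none
  ops 1 (r.getD n)

/-- The list that results from `L` by moving the agent in position `b` up to position `a`
(`L` itself, if `b` is not below `a`): both tables of the list are copied with the changes. -/
def promote {n : ℕ} (L : PrefList n) (a b : Fin n) : Timed (PrefList n) :=
  ops (10 * n + 10) ((Fin.cycleIcc a b).symm.trans L)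

/-- The profile `p` with the list of `w` replaced by `L`: all tables are copied. -/
def replace {n : ℕ} (p : WomenProfile n) (w : Woman n) (L : PrefList n) : Timed (WomenProfile n) :=
  ops (10 * n ^ 2 + 10) (Function.update p w L)

/-- One step of the dynamics: for each woman `w` and all positions `a`, `b` tabulate the rank of the
partner that `w` gets after promoting the man in position `b` of her list to position `a`; then find
a strategic woman and a promotion that is the best one for her and beneficial, and perform it. -/
def step {n : ℕ} (men : Man n → PrefList n) (Pw : Finset (Woman n)) (p : WomenProfile n) :
    Timed (WomenProfile n) := do
  let current ← table fun w => outcomeRank ⟨men, p⟩ (p w) w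
  let ranks ← table fun w => table fun a => table fun b => do
    let L ← promote (p w) a b
    let q ← replace p w L
    outcomeRank ⟨men, q⟩ (p w) w
  let choice ← first fun w => do
    let strategic ← ops 1 (decide (w ∈ Pw))
    if strategic then
      first fun a => first fun b => do
        let beneficial ← ops 3 (decide (ranks w a b < current w))
        let beaten ← any fun a' => any fun b' => ops 3 (decide (ranks w a' b' < ranks w a b))
        ops 2 (if beneficial ∧ ¬ beaten then some (w, a, b) else none)
    else ops 1 none
  match choice with
  | none => ops 1 p
  | some (w, a, b) => do
    let L ← promote (p w) a b
    replace p w L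

/-- Perform `n ^ 2` steps of the dynamics, starting from the true preferences. -/
def run {n : ℕ} (I : Market n) (Pw : Finset (Woman n)) : Timed (WomenProfile n) :=
  iterate (step I.men Pw) (n ^ 2) I.women

end Algorithm

end WomanManipulation

namespace WomanManipulation

/-! ### Preference lists -/

section Lists

variable {n : ℕ}

/-! Write μ for the deferred acceptance matching under the current lists. If a woman `w` gains by
promoting one man `d`, then `d` must already have been rejected by her in μ, and the new matching is
stable for the old lists, so by man-optimality no man gains (`IsPromotion.of_isSelfManipulation`).
Along the dynamics every man can therefore only move down his list, and some man does so at each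
step. The total number of rejections is a potential that strictly increases and is at most `n ^ 2`.

A fixed point is an equilibrium for two reasons. First, inconspicuous lists suffice: if any list
helps `w` with respect to the list she reports, then so does a single promotion
(`IsSelfManipulation.exists_isInconspicuous`). The promotion lifts, to just above her partner, the
man whom the helpful list ranks best among her suitors in μ; that it works rests on a counting
argument about rejections (`unique_further_proposal`). Second, a deviation that helps with respect
to the true list also helps with respect to the reported one: `w` promotes only men whom she has
rejected, they never come back to her, and so her current partner has not gained on anyone in her
list (`IsInconspicuousDynamics.prefers_or`).

For the algorithm, every inconspicuous list moves the man in some position `b` up to some position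
`a` (`IsInconspicuous.exists_promoted`), so exhaustive search over `w`, `a`, `b` finds an optimal
step; the cost bounds compose loop by loop. -/

theorem Prefers.trans {L : PrefList n} {x y z : Fin n} (h : Prefers L x y) (h' : Prefers L y z) :
    Prefers L x z := lt_trans h h'

theorem Prefers.asymm {L : PrefList n} {x y : Fin n} (h : Prefers L x y) : ¬ Prefers L y x :=
  lt_asymm h

theorem Prefers.ne {L : PrefList n} {x y : Fin n} (h : Prefers L x y) : x ≠ y := by
  rintro rfl
  exact lt_irrefl _ h

theorem prefers_of_not {L : PrefList n} {x y : Fin n} (h : ¬ Prefers L x y) (hne : x ≠ y) :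
    Prefers L y x :=
  lt_of_le_of_ne (not_lt.1 h) (L.symm.injective.ne hne.symm)

theorem Prefers.trans_not {L : PrefList n} {x y z : Fin n} (h : Prefers L x y)
    (h' : ¬ Prefers L z y) : Prefers L x z :=
  lt_of_lt_of_le h (not_lt.1 h')

theorem not_prefers_trans {L : PrefList n} {x y z : Fin n} (h : ¬ Prefers L x y)
    (h' : ¬ Prefers L y z) : ¬ Prefers L x z :=
  not_lt.2 ((not_lt.1 h').trans (not_lt.1 h))

/-- The position of an agent is the number of agents that are preferred to it. -/
theorem card_prefers (L : PrefList n) (x : Fin n) :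
    (Finset.univ.filter fun y => Prefers L y x).card = (L.symm x : ℕ) := by
  have : (Finset.univ.filter fun y => Prefers L y x) =
      (Finset.Iio (L.symm x)).map L.toEmbedding := by
    ext y
    simp only [Finset.mem_filter, Finset.mem_univ, true_and, Finset.mem_map, Finset.mem_Iio,
      Equiv.coe_toEmbedding]
    exact ⟨fun h => ⟨L.symm y, h, by simp⟩,
      by rintro ⟨k, hk, rfl⟩; simpa [Prefers] using hk⟩
  rw [this, Finset.card_map, Fin.card_Iio]

/-- `L'` results from `L` by promoting `d`. -/
def IsPromotion (L L' : PrefList n) (d : Fin n) : Prop :=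
  (∀ x y, x ≠ d → y ≠ d → (Prefers L' x y ↔ Prefers L x y)) ∧ ∀ x, Prefers L d x → Prefers L' d x

theorem IsPromotion.isInconspicuous {L L' : PrefList n} {d : Fin n} (h : IsPromotion L L' d) :
    IsInconspicuous L L' := ⟨d, h⟩

theorem IsPromotion.symm_le {L L' : PrefList n} {d : Fin n} (h : IsPromotion L L' d) :
    L'.symm d ≤ L.symm d := by
  rw [Fin.le_def, ← card_prefers, ← card_prefers]
  refine Finset.card_le_card fun y hy => ?_
  simp only [Finset.mem_filter, Finset.mem_univ, true_and] at hy ⊢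
  by_contra hn
  exact hy.asymm (h.2 y (prefers_of_not hn hy.ne))

/-- A promoted list is determined by the agent who is promoted and his new position. -/
theorem list_ext_of_agree {L L' : PrefList n} {d : Fin n}
    (h : ∀ x y, x ≠ d → y ≠ d → (Prefers L' x y ↔ Prefers L x y))
    (hd : L'.symm d = L.symm d) : L' = L := by
  have pos : ∀ (K : PrefList n) (x : Fin n), x ≠ d → (K.symm x : ℕ) =
      (Finset.univ.filter fun y => y ≠ d ∧ Prefers K y x).card +
        if Prefers K d x then 1 else 0 := by
    intro K x hx
    rw [← card_prefers]
    split_ifs with hp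
    · have : (Finset.univ.filter fun y => Prefers K y x) =
          insert d (Finset.univ.filter fun y => y ≠ d ∧ Prefers K y x) := by
        ext y
        by_cases hy : y = d
        · simp [hy, hp]
        · simp [hy]
      rw [this, Finset.card_insert_of_notMem (by simp)]
    · refine congrArg _ (Finset.filter_congr fun y _ => ?_)
      exact ⟨fun h => ⟨fun e => hp (e ▸ h), h⟩, And.right⟩
  have hr : ∀ x, x ≠ d → (Finset.univ.filter fun y => y ≠ d ∧ Prefers L' y x).card =
      (Finset.univ.filter fun y => y ≠ d ∧ Prefers L y x).card := fun x hx => by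
    refine congrArg _ (Finset.filter_congr fun y _ => ?_)
    exact and_congr_right fun hy => h y x hy hx
  have hs : L'.symm = L.symm := by
    ext x
    by_cases hx : x = d
    · rw [hx, hd]
    · have h1 := pos L x hx
      have h2 := pos L' x hx
      rw [hr x hx] at h2
      have hx1 : (L.symm x : ℕ) ≠ L.symm d := fun e => hx (L.symm.injective (Fin.ext e))
      have hx2 : (L'.symm x : ℕ) ≠ L'.symm d := fun e => hx (L'.symm.injective (Fin.ext e))
      have hd' : (L'.symm d : ℕ) = L.symm d := congrArg _ hd
      -- With `r` other agents above `x`, the agent `x` sits at `r` if `d` is below position `r`,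
      -- and at `r + 1` otherwise, because `x` and `d` cannot share a position. Hence `r` and the
      -- position of `d` decide it.
      generalize (Finset.univ.filter fun y => y ≠ d ∧ Prefers L y x).card = r at h1 h2
      simp only [Prefers, Fin.lt_def] at h1 h2
      split_ifs at h1 h2 <;> omega
  rw [← Equiv.symm_symm L', hs, Equiv.symm_symm]

/-- The list that results from `L` by moving the agent in position `b` up to position `a`. -/
def promoted (L : PrefList n) (a b : Fin n) : PrefList n := (Fin.cycleIcc a b).symm.trans L

theorem promoted_symm (L : PrefList n) (a b x : Fin n) :
    (promoted L a b).symm x = Fin.cycleIcc a b (L.symm x) := rfl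

theorem val_cycleIcc {a b : Fin n} (hab : a ≤ b) (k : Fin n) :
    (Fin.cycleIcc a b k : ℕ) =
      if k < a then (k : ℕ) else if k < b then (k : ℕ) + 1 else if k = b then (a : ℕ) else k := by
  have : NeZero n := ⟨by have := a.2; omega⟩
  split_ifs with h1 h2 h3
  · rw [Fin.cycleIcc_of_lt h1]
  · rw [Fin.cycleIcc_of_ge_of_lt (not_lt.1 h1) h2]
    exact Fin.val_add_one_of_lt' (by have := b.2; rw [Fin.lt_def] at h2; omega)
  · rw [h3, Fin.cycleIcc_of_last hab]
  · rw [Fin.cycleIcc_of_gt (lt_of_le_of_ne (not_lt.1 h2) (Ne.symm h3))]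

theorem isPromotion_promoted (L : PrefList n) (a b : Fin n) :
    IsPromotion L (promoted L a b) (L b) := by
  rcases le_or_gt a b with hab | hab
  · refine ⟨fun x y hx hy => ?_, fun x hx => ?_⟩
    · have hx' : (L.symm x : ℕ) ≠ b := fun h => hx (by rw [← Fin.ext h, Equiv.apply_symm_apply])
      have hy' : (L.symm y : ℕ) ≠ b := fun h => hy (by rw [← Fin.ext h, Equiv.apply_symm_apply])
      simp only [Prefers, promoted_symm, Fin.lt_def, val_cycleIcc hab, Fin.ext_iff]
      rw [Fin.le_def] at hab
      split_ifs <;> omega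
    · simp only [Prefers, promoted_symm, Fin.lt_def, val_cycleIcc hab, Fin.ext_iff,
        Equiv.symm_apply_apply] at hx ⊢
      rw [Fin.le_def] at hab
      split_ifs <;> omega
  · have : promoted L a b = L := by
      rw [promoted, Fin.cycleIcc_def_gt hab]
      rfl
    rw [this]
    exact ⟨fun _ _ _ _ => Iff.rfl, fun _ h => h⟩

/-- The inconspicuous lists are the promoted ones. -/
theorem IsInconspicuous.exists_promoted {L L' : PrefList n} (h : IsInconspicuous L L') :
    ∃ a b, L' = promoted L a b := by
  obtain ⟨d, h⟩ := h
  have hd : IsPromotion L L' d := h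
  refine ⟨L'.symm d, L.symm d, list_ext_of_agree (d := d) (fun x y hx hy => ?_) ?_⟩
  · rw [h.1 x y hx hy, (isPromotion_promoted L _ _).1 x y] <;> simpa
  · ext
    rw [promoted_symm, val_cycleIcc hd.symm_le]
    have := hd.symm_le
    rw [Fin.le_def] at this
    simp only [Fin.lt_def]
    split_ifs <;> omega

/-- Some promotion of `d` makes him preferred to `c`, but not to those who are preferred to `c`. -/
theorem exists_promotion_to {L : PrefList n} {c d : Fin n} (hcd : Prefers L c d) :
    ∃ L', IsPromotion L L' d ∧ (∀ x, Prefers L x c → Prefers L' x d) ∧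
      ∀ x, ¬ Prefers L x c → x ≠ d → Prefers L' d x := by
  refine ⟨promoted L (L.symm c) (L.symm d), by
    simpa using isPromotion_promoted L (L.symm c) (L.symm d), fun x hx => ?_, fun x hx hxd => ?_⟩
  · simp only [Prefers, promoted_symm, Fin.lt_def, val_cycleIcc (le_of_lt hcd), Fin.ext_iff]
      at hx hcd ⊢
    split_ifs <;> omega
  · have hx' : (L.symm x : ℕ) ≠ L.symm d := fun h => hxd (L.symm.injective (Fin.ext h))
    simp only [Prefers, promoted_symm, Fin.lt_def, val_cycleIcc (le_of_lt hcd), Fin.ext_iff]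
      at hx hcd ⊢
    split_ifs <;> omega

end Lists

/-! ### Stability of deferred acceptance -/

section Stability

variable {n : ℕ} {men : Man n → PrefList n} {p : WomenProfile n}

/-- A matching is stable if no man and woman prefer each other to their partners. -/
def IsStable (men : Man n → PrefList n) (p : WomenProfile n) (ν : Matching n) : Prop :=
  ∀ m v, Prefers (men m) v (ν m) → ¬ Prefers (p v) m (ν.symm v)

/-- The man `m` gets to propose to `v` if the relation `R` describes who is rejected by whom. -/
def Reaches (men : Man n → PrefList n) (R : Man n → Woman n → Prop) (m : Man n) (v : Woman n) :
    Prop :=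
  ∀ u, Prefers (men m) u v → R m u

theorem target_eq_some {k : Man n → ℕ} {m : Man n} {v : Woman n} :
    DA.target men k m = some v ↔ k m = (men m).symm v := by
  unfold DA.target
  split_ifs with h
  · rw [Option.some.injEq, ← Equiv.eq_symm_apply, Fin.ext_iff]
  · simp only [false_iff]
    exact fun e => h (e ▸ Fin.is_lt _)

theorem symm_deferredAcceptance (I : Market n) (m : Man n) :
    ((I.men m).symm (deferredAcceptance I m) : ℕ) = DA.state I (n ^ 2) m := by
  simp [deferredAcceptance, DA.partner]

/-- Every relation that is closed under the rejection rule contains all rejections of deferred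
acceptance. -/
theorem rejected_of_closed {R : Man n → Woman n → Prop}
    (hR : ∀ m m' v, Reaches men R m v → Reaches men R m' v → Prefers (p v) m' m → R m v)
    {m : Man n} {v : Woman n} (h : Prefers (men m) v (deferredAcceptance ⟨men, p⟩ m)) : R m v := by
  have key : ∀ t m v, ((men m).symm v : ℕ) < DA.state ⟨men, p⟩ t m → R m v := by
    intro t
    induction t with
    | zero => intro m v h; simp [DA.state] at h
    | succ t ih =>
      intro m v h
      by_cases hlt : ((men m).symm v : ℕ) < DA.state ⟨men, p⟩ t m
      · exact ih m v hlt
      · simp only [DA.state, DA.round] at h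
        split_ifs at h with hr
        · have heq : DA.state ⟨men, p⟩ t m = (men m).symm v := by omega
          obtain ⟨v', hv', m', hm', hp⟩ := hr
          rw [target_eq_some] at hv' hm'
          have hvv : v' = v := (men m).symm.injective (Fin.ext (hv'.symm.trans heq))
          subst hvv
          refine hR m m' v' (fun u hu => ih m u ?_) (fun u hu => ih m' u ?_) hp
          · rw [hv']; exact hu
          · rw [hm']; exact hu
        · exact absurd h hlt
  refine key (n ^ 2) m v ?_
  rw [← symm_deferredAcceptance]
  exact h

/-- The invariant `key` says that a woman who has rejected `m` holds a proposal from someone she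
prefers to `m`. It survives a round because her favourite current suitor is not rejected. -/
theorem isStable_deferredAcceptance (men : Man n → PrefList n) (p : WomenProfile n) :
    IsStable men p (deferredAcceptance ⟨men, p⟩) := by
  set μ := deferredAcceptance ⟨men, p⟩ with hμ
  have key : ∀ t m v, ((men m).symm v : ℕ) < DA.state ⟨men, p⟩ t m →
      ∃ m', DA.target men (DA.state ⟨men, p⟩ t) m' = some v ∧ Prefers (p v) m' m := by
    intro t
    induction t with
    | zero => intro m v h; simp [DA.state] at h
    | succ t ih =>
      intro m v h
      have h1 : ∃ m', DA.target men (DA.state ⟨men, p⟩ t) m' = some v ∧ Prefers (p v) m' m := by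
        by_cases hlt : ((men m).symm v : ℕ) < DA.state ⟨men, p⟩ t m
        · exact ih m v hlt
        · simp only [DA.state, DA.round] at h
          split_ifs at h with hr
          · have heq : DA.state ⟨men, p⟩ t m = (men m).symm v := by omega
            obtain ⟨v', hv', m', hm', hp⟩ := hr
            have hvv : v' = v :=
              (men m).symm.injective (Fin.ext ((target_eq_some.1 hv').symm.trans heq))
            subst hvv
            exact ⟨m', hm', hp⟩
          · exact absurd h hlt
      obtain ⟨m₁, hm₁, hp₁⟩ := h1
      obtain ⟨b, hbS, hb⟩ := (Finset.univ.filter fun m' =>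
        DA.target men (DA.state ⟨men, p⟩ t) m' = some v).exists_min_image
          (fun m' => (p v).symm m') ⟨m₁, by simp [hm₁]⟩
      have hbt : DA.target men (DA.state ⟨men, p⟩ t) b = some v := by simpa using hbS
      have hnr : ¬ DA.Rejected ⟨men, p⟩ (DA.state ⟨men, p⟩ t) b := by
        rintro ⟨w, hw, m', hm', hp⟩
        have hw : DA.target men (DA.state ⟨men, p⟩ t) b = some w := hw
        rw [hbt, Option.some.injEq] at hw
        subst hw
        exact absurd hp (not_lt.2 (hb m' (by simpa using hm')))
      refine ⟨b, ?_, lt_of_le_of_lt (hb m₁ (by simpa using hm₁)) hp₁⟩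
      rw [target_eq_some] at hbt ⊢
      rw [← hbt]
      simp [DA.state, DA.round, hnr]
  intro m v h hb
  obtain ⟨m', hm', hp⟩ := key (n ^ 2) m v (by
    have := symm_deferredAcceptance ⟨men, p⟩ m
    rw [← this]
    exact h)
  rw [target_eq_some, ← symm_deferredAcceptance ⟨men, p⟩ m'] at hm'
  have : μ m' = v := (men m').symm.injective (Fin.ext hm')
  rw [← this, Equiv.symm_apply_apply] at hb
  rw [this] at hb
  exact hp.asymm hb

/-- No man prefers his partner in a stable matching to his partner in deferred acceptance. -/
theorem deferredAcceptance_man_optimal {ν : Matching n} (hν : IsStable men p ν)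
    {m : Man n} : ¬ Prefers (men m) (ν m) (deferredAcceptance ⟨men, p⟩ m) := by
  intro h
  -- The relation is closed: if `ν m` rejected `m` in favour of `m'`, then `m'`, who reaches her
  -- only after women better than `ν m'`, would block `ν` with her.
  have := rejected_of_closed (p := p) (R := fun m v => Prefers (men m) v (ν m)) ?_ h
  · exact this.ne rfl
  · intro m m' v hm hm' hp
    have hge : ∀ x, Reaches men (fun m v => Prefers (men m) v (ν m)) x v →
        ¬ Prefers (men x) (ν x) v := fun x hx h => (hx _ h).ne rfl
    refine prefers_of_not (hge m hm) ?_
    rintro rfl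
    refine hν m' (ν m) (prefers_of_not (hge m' hm') fun e => hp.ne (ν.injective e)) ?_
    rwa [Equiv.symm_apply_apply]

/-- A rule that is closed on those who get to propose in deferred acceptance contains all
rejections. -/
theorem rejected_of_relatively_closed {R : Man n → Woman n → Prop}
    (hR : ∀ m m' v, ¬ Prefers (men m) (deferredAcceptance ⟨men, p⟩ m) v →
      ¬ Prefers (men m') (deferredAcceptance ⟨men, p⟩ m') v → deferredAcceptance ⟨men, p⟩ m ≠ v →
      Reaches men R m v → Reaches men R m' v → Prefers (p v) m' m → R m v)
    {m : Man n} {v : Woman n} (h : Prefers (men m) v (deferredAcceptance ⟨men, p⟩ m)) : R m v := by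
  set μ := deferredAcceptance ⟨men, p⟩ with hμ
  refine (rejected_of_closed (p := p)
    (R := fun m v => R m v ∧ Prefers (men m) v (μ m)) ?_ h).1
  intro m m' v hm hm' hp
  have hge : ∀ x, Reaches men (fun m v => R m v ∧ Prefers (men m) v (μ m)) x v →
      ¬ Prefers (men x) (μ x) v := fun x hx h => (hx _ h).2.ne rfl
  have hne : μ m ≠ v := by
    rintro rfl
    refine isStable_deferredAcceptance men p m' (μ m)
      (prefers_of_not (hge m' hm') fun e => hp.ne (μ.injective e)) ?_
    rwa [← hμ, Equiv.symm_apply_apply]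
  exact ⟨hR m m' v (hge m hm) (hge m' hm') hne (fun u hu => (hm u hu).1) (fun u hu => (hm' u hu).1)
    hp, prefers_of_not (hge m hm) hne⟩

end Stability

/-! ### Manipulations by one woman -/

section Manipulation

variable {n : ℕ} {men : Man n → PrefList n} {p : WomenProfile n} {w : Woman n}

/-- Blocking pairs that avoid `w` do not see her list, so only men who prefer `w` to their partners
need to be checked. -/
theorem IsStable.of_update {L L' : PrefList n} {ν : Matching n}
    (h : IsStable men (Function.update p w L) ν)
    (hw : ∀ m, Prefers (men m) w (ν m) → Prefers L' m (ν.symm w) → Prefers L m (ν.symm w)) :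
    IsStable men (Function.update p w L') ν := by
  intro m v hm hv
  have := h m v hm
  by_cases hvw : v = w
  · subst hvw
    simp only [Function.update_self] at this hv
    exact this (hw m hm hv)
  · simp only [Function.update_of_ne hvw] at this hv
    exact this hv

/-- If `w` benefits from promoting `d`, then deferred acceptance does not give her a man who is at
least as good for `d` as she is, and no man benefits. -/
theorem IsPromotion.of_isSelfManipulation {L : PrefList n} {d : Man n}
    (hL : IsPromotion (p w) L d) (h : IsSelfManipulation men (p w) p w L) :
    Prefers (men d) w (deferredAcceptance ⟨men, p⟩ d) ∧
      ∀ m, ¬ Prefers (men m) (deferredAcceptance ⟨men, Function.update p w L⟩ m)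
        (deferredAcceptance ⟨men, p⟩ m) := by
  have hμ := isStable_deferredAcceptance men p
  have hμ' := isStable_deferredAcceptance men (Function.update p w L)
  have hopt := @deferredAcceptance_man_optimal n men p
  have hopt' := @deferredAcceptance_man_optimal n men (Function.update p w L)
  unfold IsSelfManipulation outcome at h
  set μ := deferredAcceptance ⟨men, p⟩
  set μ' := deferredAcceptance ⟨men, Function.update p w L⟩
  -- If μ stayed stable, man-optimality of μ' would make the new partner of `w` like her at least as
  -- much as his partner in μ, and the two would block μ.
  have hns : ¬ IsStable men (Function.update p w L) μ := by
    intro hs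
    have hb := hopt' hs (m := μ'.symm w)
    rw [Equiv.apply_symm_apply] at hb
    exact hμ (μ'.symm w) w (prefers_of_not hb fun e => h.ne (μ.eq_symm_apply.2 e)) h
  have hpw : IsStable men (Function.update p w (p w)) μ := by rwa [Function.update_eq_self]
  -- Only the promotion of `d` can have destroyed stability, so `d` forms the blocking pair with
  -- `w`.
  have hd : Prefers (men d) w (μ d) ∧ Prefers L d (μ.symm w) := by
    by_contra hd
    refine hns (hpw.of_update fun m hm hmL => ?_)
    by_cases hmd : m = d
    · subst hmd
      exact absurd ⟨hm, hmL⟩ hd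
    by_cases hcd : μ.symm w = d
    · rw [hcd] at hmL ⊢
      by_contra hn
      exact hmL.asymm (hL.2 m (prefers_of_not hn hmd))
    · exact (hL.1 _ _ hmd hcd).1 hmL
  refine ⟨hd.1, fun m => hopt (m := m) ?_⟩
  have hbd : μ'.symm w ≠ d := by
    intro e
    rw [e] at h
    exact hμ d w hd.1 h
  -- As her new partner is not `d`, undoing the promotion moves nobody above him. So μ' is stable
  -- under `p`, and μ is man-optimal there.
  rw [← Function.update_eq_self w p]
  refine hμ'.of_update fun m hm hmp => ?_
  by_cases hmd : m = d
  · rw [hmd] at hmp ⊢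
    exact hL.2 _ hmp
  · exact (hL.1 _ _ hmd hbd).2 hmp

/-- The rejections that occur if `w` rejects the men in `S` and nobody else, while all other women
behave according to `p`. -/
inductive Rej (men : Man n → PrefList n) (p : WomenProfile n) (w : Woman n) (S : Set (Man n)) :
    Man n → Woman n → Prop
  | self (m : Man n) : m ∈ S → (∀ u, Prefers (men m) u w → Rej men p w S m u) → Rej men p w S m w
  | other (m m' : Man n) (v : Woman n) : v ≠ w →
      (∀ u, Prefers (men m) u v → Rej men p w S m u) →
      (∀ u, Prefers (men m') u v → Rej men p w S m' u) → Prefers (p v) m' m → Rej men p w S m v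

theorem Rej.mem {S : Set (Man n)} {m : Man n} (h : Rej men p w S m w) : m ∈ S := by
  cases h with
  | self _ h _ => exact h
  | other _ _ _ h => exact absurd rfl h

/-- If `w` rejects every man who proposes to her in deferred acceptance, then she gets at most one
further proposal. -/
theorem unique_further_proposal {C : Set (Man n)}
    (hC : ∀ m, ¬ Prefers (men m) (deferredAcceptance ⟨men, p⟩ m) w → m ∈ C) {y y' : Man n}
    (hy : Reaches men (Rej men p w C) y w) (hyC : y ∉ C)
    (hy' : Reaches men (Rej men p w C) y' w) (hyC' : y' ∉ C) : y = y' := by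
  classical
  have hrej : ∀ m v, Prefers (men m) v (deferredAcceptance ⟨men, p⟩ m) → Rej men p w C m v := by
    intro m v hmv
    refine rejected_of_relatively_closed (p := p) (fun m m' v hm _ _ hr hr' hp => ?_) hmv
    by_cases hvw : v = w
    · subst hvw
      exact Rej.self m (hC m hm) hr
    · exact Rej.other m m' v hvw hr hr' hp
  -- Every other woman is reached at least by her deferred acceptance partner, so the favourite
  -- among those who reach her remains with her.
  have hhold : ∀ v, v ≠ w → ∃ h, Reaches men (Rej men p w C) h v ∧ ¬ Rej men p w C h v := by
    intro v hv
    obtain ⟨h, hh, hmin⟩ := (Finset.univ.filter fun m =>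
      Reaches men (Rej men p w C) m v).exists_min_image (fun m => (p v).symm m)
        ⟨(deferredAcceptance ⟨men, p⟩).symm v, by
          simp only [Finset.mem_filter, Finset.mem_univ, true_and]
          exact fun u hu => hrej _ _ (by rwa [Equiv.apply_symm_apply])⟩
    refine ⟨h, by simpa using hh, fun hr => ?_⟩
    cases hr with
    | self => exact hv rfl
    | other _ m' _ _ _ hr' hp =>
      exact absurd hp (not_lt.2 (hmin m' (Finset.mem_filter.2 ⟨Finset.mem_univ _, hr'⟩)))
  choose! f hf using hhold
  have hg : ∀ v, Reaches men (Rej men p w C) (if v = w then y else f v) v ∧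
      ¬ Rej men p w C (if v = w then y else f v) v := by
    intro v
    split_ifs with hv
    · subst hv
      exact ⟨hy, fun h => hyC h.mem⟩
    · exact hf v hv
  have huniq : ∀ m v v', Reaches men (Rej men p w C) m v → ¬ Rej men p w C m v →
      Reaches men (Rej men p w C) m v' → ¬ Rej men p w C m v' → v = v' := by
    intro m v v' h1 h2 h3 h4
    by_contra hne
    by_cases hlt : Prefers (men m) v v'
    · exact h2 (h3 v hlt)
    · exact h4 (h1 v' (prefers_of_not hlt hne))
  -- The holders together with `y` at `w` are `n` distinct men, hence all men. So `y'`, who also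
  -- waits unrejected at `w`, must be `y`.
  have hinj : Function.Injective fun v => if v = w then y else f v := by
    intro v v' e
    have h1 := hg v
    have h2 := hg v'
    simp only at e
    rw [← e] at h2
    exact huniq _ _ _ h1.1 h1.2 h2.1 h2.2
  obtain ⟨v, hv⟩ := (Finite.injective_iff_surjective.1 hinj) y'
  have h1 := hg v
  simp only at hv
  rw [hv] at h1
  have := huniq _ _ _ h1.1 h1.2 hy' fun h => hyC' h.mem
  rw [if_pos this] at hv
  exact hv

/-- A woman who has a self-manipulation also has an inconspicuous one. -/
theorem IsSelfManipulation.exists_isInconspicuous {L : PrefList n}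
    (h : IsSelfManipulation men (p w) p w L) :
    ∃ P, IsInconspicuous (p w) P ∧ IsSelfManipulation men (p w) p w P := by
  classical
  have hμ := isStable_deferredAcceptance men p
  have hopt := @deferredAcceptance_man_optimal n men p
  have hoptL := @deferredAcceptance_man_optimal n men (Function.update p w L)
  have hclosL := @rejected_of_closed n men (Function.update p w L)
  have hcount := @unique_further_proposal n men p w
  unfold IsSelfManipulation outcome at h ⊢
  set μ := deferredAcceptance ⟨men, p⟩
  set ν := deferredAcceptance ⟨men, Function.update p w L⟩
  set c := μ.symm w with hc
  set b := ν.symm w with hb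
  have hμc : μ c = w := by simp [hc]
  have hνb : ν b = w := by simp [hb]
  have hbA : Prefers (men b) (μ b) w := by
    by_contra hn
    refine hμ b w (prefers_of_not hn fun e => h.ne ?_) h
    rw [hc, ← e, Equiv.symm_apply_apply]
  -- `d` is the favourite of the list `L` among the men who propose to `w` in μ; he is the man to
  -- promote.
  obtain ⟨d, hdA, hdmin⟩ : ∃ d, ¬ Prefers (men d) (μ d) w ∧
      ∀ m, ¬ Prefers (men m) (μ m) w → ¬ Prefers L m d := by
    obtain ⟨d, hd, hmin⟩ := (Finset.univ.filter fun m =>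
      ¬ Prefers (men m) (μ m) w).exists_min_image (fun m => L.symm m)
        ⟨c, by
          simp only [Finset.mem_filter, Finset.mem_univ, true_and, hμc]
          exact fun h => h.ne rfl⟩
    exact ⟨d, by simpa using hd, fun m hm => not_lt.2 (hmin m (by simpa using hm))⟩
  have hstab : ∀ {ρ : Matching n} {K : PrefList n}, IsStable men (Function.update p w K) ρ →
      (∀ m, Prefers (men m) w (ρ m) → ¬ Prefers L m (ρ.symm w)) → Prefers (men b) (ρ b) w →
      False := by
    intro ρ K hρ hL hbρ
    refine hoptL (hρ.of_update fun m hm hmL => absurd hmL (hL m hm)) (m := b) ?_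
    rwa [hνb]
  -- If `L` ranked `c` first among these men, μ would be stable under `L`, although `b` prefers his
  -- partner in μ to `w`.
  have hdc : d ≠ c := by
    intro e
    refine hstab (K := p w) (ρ := μ) (by rwa [Function.update_eq_self]) (fun m hm => ?_) hbA
    rw [← hc, ← e]
    exact hdmin m hm.asymm
  have hcd : Prefers (p w) c d := by
    refine prefers_of_not (hμ d w (prefers_of_not hdA fun e => hdc ?_)) hdc
    rw [hc, ← e, Equiv.symm_apply_apply]
  obtain ⟨P, hP, hPc, hPd⟩ := exists_promotion_to hcd
  refine ⟨P, hP.isInconspicuous, ?_⟩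
  by_contra hfail
  have hμ' := isStable_deferredAcceptance men (Function.update p w P)
  have hclosP := @rejected_of_relatively_closed n men (Function.update p w P)
  set μ' := deferredAcceptance ⟨men, Function.update p w P⟩
  set e := μ'.symm w with he
  have hμ'e : μ' e = w := by simp [he]
  have heP : ∀ x, ¬ Prefers (men x) (μ' x) w → x ≠ e → Prefers P e x := by
    intro x hx hxe
    have := hμ' x w (prefers_of_not hx fun e' => hxe (by rw [he, ← e', Equiv.symm_apply_apply]))
    rw [Function.update_self] at this
    exact prefers_of_not this hxe
  have hXc : ∀ x, ¬ Prefers (men x) (μ' x) w → ¬ Prefers (p w) x c := by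
    intro x hx hxc
    have hxe : x ≠ e := by
      rintro rfl
      exact hfail hxc
    have hex := heP x hx hxe
    by_cases hed : e = d
    · rw [hed] at hex
      exact hex.asymm (hPc x hxc)
    · have hxd : x ≠ d := by
        rintro rfl
        exact hxc.asymm hcd
      exact hfail (((hP.1 e x hed hxd).1 hex).trans hxc)
  -- If `d` did not propose to `w` in μ', his promotion would be irrelevant and μ' stable under `p`.
  -- Then `d` would fare no better in μ' than in μ, where he does propose to her.
  have hdX : ¬ Prefers (men d) (μ' d) w := by
    intro hdX
    have hs : IsStable men p μ' := by
      rw [← Function.update_eq_self w p]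
      refine hμ'.of_update fun m hm hmp => ?_
      refine (hP.1 _ _ ?_ ?_).2 hmp
      · rintro rfl
        exact hm.asymm hdX
      · rintro e'
        rw [← e', ← he, hμ'e] at hdX
        exact hdX.ne rfl
    exact not_prefers_trans (hopt hs) hdA hdX
  have hed : e = d := by
    by_contra hed
    exact (heP d hdX (Ne.symm hed)).asymm (hPd e hfail hed)
  have hbX : Prefers (men b) (μ' b) w := by
    by_contra hn
    exact hXc b hn h
  -- Otherwise μ' would be stable under `L`, which `hstab` excludes.
  obtain ⟨z, hzX, hzL⟩ : ∃ z, ¬ Prefers (men z) (μ' z) w ∧ Prefers L z d := by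
    by_contra! hn
    refine hstab (ρ := μ') hμ' (fun m hm => ?_) hbX
    rw [← he, hed]
    exact hn m hm.asymm
  -- Among the suitors of `w` in μ or μ', those outside `C` are the ones whom `L` ranks above `d`,
  -- such as `z`. All suitors in μ lie in `C`, so the counting lemma allows at most one proposal
  -- from outside `C`.
  let C : Set (Man n) := {m | (¬ Prefers (men m) (μ' m) w ∨ ¬ Prefers (men m) (μ m) w) ∧
    ¬ Prefers L m d}
  have hAC : ∀ m, ¬ Prefers (men m) (μ m) w → m ∈ C := fun m hm => ⟨Or.inr hm, hdmin m hm⟩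
  -- If the one outside proposer `y` were no suitor in μ', all rejections of μ' would be derivable
  -- with `C`. Then `z` would also propose from outside, forcing `z = y`.
  have hyX : ∀ y, Reaches men (Rej men p w C) y w → y ∉ C → ¬ Prefers (men y) (μ' y) w := by
    intro y hy hyC
    by_contra hyX
    have hrej : ∀ m v, Prefers (men m) v (μ' m) → Rej men p w C m v := by
      intro m v hmv
      refine hclosP (fun m m' v hm _ _ hr hr' hp => ?_) hmv
      by_cases hvw : v = w
      · subst hvw
        refine Rej.self m ?_ hr
        by_contra hmC
        rw [hcount hAC hr hmC hy hyC] at hm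
        exact hm hyX
      · rw [Function.update_of_ne hvw] at hp
        exact Rej.other m m' v hvw hr hr' hp
    have hzC : z ∉ C := fun hz => hz.2 hzL
    have hzy := hcount hAC (fun u hu => hrej z u (hu.trans_not hzX)) hzC hy hyC
    rw [hzy] at hzX
    exact hzX hyX
  -- The rejections under `L` are derivable with `C`: were `w` to reject some `m ∉ C` for `m'`, both
  -- would rank above `d` in `L` and be two distinct outside proposers.
  have hbr : Reaches men (Rej men p w C) b w := by
    intro u hu
    refine hclosL (fun m m' v hr hr' hp => ?_) (hνb.symm ▸ hu)
    by_cases hvw : v = w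
    · subst hvw
      rw [Function.update_self] at hp
      refine Rej.self m ?_ hr
      by_contra hmC
      have hmd : Prefers L m d := by
        by_contra hn
        exact hmC ⟨Or.inl (hyX m hr hmC), hn⟩
      refine hp.ne (hcount hAC hr' (fun hm' => hm'.2 (hp.trans hmd)) hr hmC)
    · rw [Function.update_of_ne hvw] at hp
      exact Rej.other m m' v hvw hr hr' hp
  by_cases hbC : b ∈ C
  · exact hbC.1.elim (fun h => h hbX) (fun h => h hbA)
  · exact hyX b hbr hbC hbX

/-- A woman who has a self-manipulation also has an optimal inconspicuous one. -/
theorem IsSelfManipulation.exists_isOptimalInconspicuous {L : PrefList n}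
    (h : IsSelfManipulation men (p w) p w L) : ∃ P, IsOptimalInconspicuous men p w P := by
  classical
  obtain ⟨P₀, h₀⟩ := h.exists_isInconspicuous
  obtain ⟨P, hP, hmin⟩ := (Finset.univ.filter fun P => IsInconspicuous (p w) P ∧
    IsSelfManipulation men (p w) p w P).exists_min_image
      (fun P => (p w).symm (outcome men (Function.update p w P) w)) ⟨P₀, by simpa using h₀⟩
  simp only [Finset.mem_filter, Finset.mem_univ, true_and] at hP hmin
  exact ⟨P, hP.1, hP.2, fun L' h1 h2 => not_lt.2 (hmin L' ⟨h1, h2⟩)⟩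

end Manipulation

/-! ### The inconspicuous dynamics -/

section Dynamics

variable {n : ℕ} {men : Man n → PrefList n} {Pw : Finset (Woman n)}

/-- The total number of women who have rejected a man when deferred acceptance stops. -/
noncomputable def totalRejections (men : Man n → PrefList n) (p : WomenProfile n) : ℕ :=
  ∑ m, ((men m).symm (deferredAcceptance ⟨men, p⟩ m) : ℕ)

theorem totalRejections_le (men : Man n → PrefList n) (p : WomenProfile n) :
    totalRejections men p ≤ n ^ 2 := by
  refine (Finset.sum_le_card_nsmul _ _ n fun m _ => (Fin.is_lt _).le).trans ?_
  simp [sq]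

theorem IsManipulationStep.not_prefers {p q : WomenProfile n} (h : IsManipulationStep men Pw p q)
    (m : Man n) :
    ¬ Prefers (men m) (deferredAcceptance ⟨men, q⟩ m) (deferredAcceptance ⟨men, p⟩ m) := by
  obtain ⟨w, -, L, ⟨⟨d, hd⟩, hL, -⟩, rfl⟩ := h
  exact (IsPromotion.of_isSelfManipulation (d := d) hd hL).2 m

/-- No man moves up his list, and the matching changes because the manipulating woman gets a new
partner. -/
theorem IsManipulationStep.totalRejections_lt {p q : WomenProfile n}
    (h : IsManipulationStep men Pw p q) : totalRejections men p < totalRejections men q := by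
  have hle : ∀ m, (men m).symm (deferredAcceptance ⟨men, p⟩ m) ≤
      (men m).symm (deferredAcceptance ⟨men, q⟩ m) := fun m => not_lt.1 (h.not_prefers m)
  refine Finset.sum_lt_sum (fun m _ => hle m) ?_
  by_contra! hn
  have heq : deferredAcceptance ⟨men, p⟩ = deferredAcceptance ⟨men, q⟩ :=
    Equiv.ext fun m => (men m).symm.injective
      (le_antisymm (hle m) (hn m (Finset.mem_univ m)))
  obtain ⟨w, -, L, ⟨-, hL, -⟩, rfl⟩ := h
  unfold IsSelfManipulation outcome at hL
  rw [← heq] at hL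
  exact hL.ne rfl

/-- Genuine steps at all times `0, …, n ^ 2` would push the potential to `n ^ 2 + 1`, above its
bound. -/
theorem IsInconspicuousDynamics.exists_not_isManipulationStep {I : Market n}
    {p : ℕ → WomenProfile n} (h : IsInconspicuousDynamics I Pw p) :
    ∃ T ≤ n ^ 2, ¬ ∃ q, IsManipulationStep I.men Pw (p T) q := by
  by_contra! hn
  have key : ∀ t, t ≤ n ^ 2 + 1 → t ≤ totalRejections I.men (p t) := by
    intro t
    induction t with
    | zero => exact fun _ => Nat.zero_le _
    | succ t ih =>
      intro ht
      rcases h.2 t with hs | hs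
      · exact (ih (by omega)).trans_lt hs.totalRejections_lt
      · exact absurd (hn t (by omega)) hs.1
  exact absurd ((key _ le_rfl).trans (totalRejections_le _ _)) (by omega)

theorem IsInconspicuousDynamics.eq_of_not_isManipulationStep {I : Market n}
    {p : ℕ → WomenProfile n} (h : IsInconspicuousDynamics I Pw p) {T : ℕ}
    (hT : ¬ ∃ q, IsManipulationStep I.men Pw (p T) q) {t : ℕ} (ht : T ≤ t) : p t = p T := by
  induction t, ht using Nat.le_induction with
  | base => rfl
  | succ t _ ih =>
    rcases h.2 t with hs | hs
    · rw [ih] at hs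
      exact absurd ⟨_, hs⟩ hT
    · rw [hs.2, ih]

theorem IsInconspicuousDynamics.eq_women {I : Market n} {p : ℕ → WomenProfile n}
    (h : IsInconspicuousDynamics I Pw p) {w : Woman n} (hw : w ∉ Pw) (t : ℕ) :
    p t w = I.women w := by
  induction t with
  | zero => rw [h.1]
  | succ t ih =>
    rcases h.2 t with ⟨w', hw', L, -, hq⟩ | hs
    · rw [hq, Function.update_of_ne (by rintro rfl; exact hw hw'), ih]
    · rw [hs.2, ih]

/-- In the course of the dynamics, a man `y` is promoted only by women whom he prefers to his
partner. -/
theorem IsInconspicuousDynamics.prefers_or {I : Market n} {p : ℕ → WomenProfile n}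
    (h : IsInconspicuousDynamics I Pw p) (t : ℕ) {w : Woman n} {x y : Man n}
    (hxy : Prefers (I.women w) x y) :
    Prefers (p t w) x y ∨ Prefers (I.men y) w (deferredAcceptance ⟨I.men, p t⟩ y) := by
  induction t with
  | zero => left; rwa [h.1]
  | succ t ih =>
    rcases h.2 t with hs | hs
    · rcases ih with ih | ih
      · have hmono := hs.not_prefers y
        obtain ⟨w', -, L, ⟨⟨d, hd⟩, hL, -⟩, hq⟩ := hs
        by_cases hw : w = w'
        · subst hw
          -- Only a promotion of `y` himself can lift him above `x`. He then preferred `w` to his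
          -- partner before the step, and his partner does not improve.
          by_cases hyd : y = d
          · subst hyd
            right
            exact (IsPromotion.of_isSelfManipulation (d := y) hd hL).1.trans_not hmono
          · left
            rw [hq, Function.update_self]
            by_cases hxd : x = d
            · subst hxd
              exact hd.2 y ih
            · exact (hd.1 x y hxd hyd).2 ih
        · left
          rwa [hq, Function.update_of_ne hw]
      · exact Or.inr (ih.trans_not (hs.not_prefers y))
    · rwa [hs.2]

/-- Apply `prefers_or` with `y` the current partner of `w`: he cannot prefer `w` to his partner, who
is `w`, so the deviation already pays off in her reported list. -/
theorem IsInconspicuousDynamics.isNashEquilibrium {I : Market n} {p : ℕ → WomenProfile n}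
    (h : IsInconspicuousDynamics I Pw p) {T : ℕ}
    (hT : ¬ ∃ q, IsManipulationStep I.men Pw (p T) q) : IsNashEquilibrium I Pw (p T) := by
  refine ⟨fun w hw => h.eq_women hw T, fun w hw L hL => ?_⟩
  rcases h.prefers_or T hL with hp | hp
  · obtain ⟨P, hP⟩ := IsSelfManipulation.exists_isOptimalInconspicuous (L := L) hp
    exact hT ⟨_, w, hw, P, hP, rfl⟩
  · simp only [outcome, Equiv.apply_symm_apply] at hp
    exact hp.ne rfl

end Dynamics

/-! ### Correctness of the algorithm -/

namespace Timed

variable {α β : Type} {n : ℕ}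

theorem bind_val (x : Timed α) (f : α → Timed β) : (x >>= f).val = (f x.val).val := rfl

theorem bind_cost (x : Timed α) (f : α → Timed β) : (x >>= f).cost = x.cost + (f x.val).cost := rfl

theorem ops_val (c : ℕ) (a : α) : (ops c a).val = a := rfl

theorem ops_cost (c : ℕ) (a : α) : (ops c a).cost = c := rfl

theorem table_val (f : Fin n → Timed α) (i : Fin n) : (table f).val i = (f i).val := rfl

theorem any_val (f : Fin n → Timed Bool) : (any f).val = decide (∃ i, (f i).val = true) := rfl

theorem of_first_eq_some {f : Fin n → Timed (Option α)} {a : α} (h : (first f).val = some a) :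
    ∃ i, (f i).val = some a := by
  obtain ⟨i, -, hi⟩ := List.exists_of_findSome?_eq_some h
  exact ⟨i, hi⟩

theorem of_first_eq_none {f : Fin n → Timed (Option α)} (h : (first f).val = none) (i : Fin n) :
    (f i).val = none :=
  List.findSome?_eq_none_iff.1 h i (List.mem_finRange i)

theorem iterate_succ_val (f : α → Timed α) (t : ℕ) (a : α) :
    (iterate f (t + 1) a).val = (f (iterate f t a).val).val := rfl

theorem sum_cost_le {f : Fin n → Timed α} {c : ℕ} (h : ∀ i, (f i).cost ≤ c) :
    1 + ∑ i, ((f i).cost + 2) ≤ 1 + n * (c + 2) := by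
  have := Finset.sum_le_card_nsmul Finset.univ (fun i => (f i).cost + 2) (c + 2)
    fun i _ => Nat.add_le_add_right (h i) 2
  simpa using this

theorem table_cost_le {f : Fin n → Timed α} {c : ℕ} (h : ∀ i, (f i).cost ≤ c) :
    (table f).cost ≤ 1 + n * (c + 2) := sum_cost_le h

theorem first_cost_le {f : Fin n → Timed (Option α)} {c : ℕ} (h : ∀ i, (f i).cost ≤ c) :
    (first f).cost ≤ 1 + n * (c + 2) := sum_cost_le h

theorem any_cost_le {f : Fin n → Timed Bool} {c : ℕ} (h : ∀ i, (f i).cost ≤ c) :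
    (any f).cost ≤ 1 + n * (c + 2) := sum_cost_le h

theorem iterate_cost_le {f : α → Timed α} {c : ℕ} (h : ∀ a, (f a).cost ≤ c) (t : ℕ) (a : α) :
    (iterate f t a).cost ≤ 1 + t * (c + 2) := by
  induction t with
  | zero => exact Nat.le_add_right 1 _
  | succ t ih =>
    have : (iterate f (t + 1) a).cost =
        (iterate f t a).cost + ((f (iterate f t a).val).cost + 2) := rfl
    have := h (iterate f t a).val
    rw [Nat.succ_mul]
    omega

end Timed

namespace Algorithm

open Timed

variable {n : ℕ}

theorem rejected_val (I : Market n) (k : Man n → ℕ) (m : Man n) :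
    (rejected I k m).val = decide (DA.Rejected I k m) := by
  unfold rejected
  rw [bind_val]
  cases h : (target I.men k m).val with
  | none =>
    have h : DA.target I.men k m = none := h
    simp [ops_val, DA.Rejected, h]
  | some w =>
    have h : DA.target I.men k m = some w := h
    simp only [any_val, DA.Rejected, h, Option.some.injEq, exists_eq_left', bind_val, ops_val]
    refine decide_eq_decide.2 (exists_congr fun m' => ?_)
    by_cases h' : DA.target I.men k m' = some w
    · simp [target, prefers, ops_val, h']
    · simp [target, ops_val, h']

theorem rejected_cost_le (I : Market n) (k : Man n → ℕ) (m : Man n) :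
    (rejected I k m).cost ≤ 4 + 9 * n := by
  unfold rejected
  rw [bind_cost]
  have h3 : (target I.men k m).cost = 3 := rfl
  rw [h3]
  split
  · rw [ops_cost]; omega
  · refine (Nat.add_le_add_left (any_cost_le (c := 7) fun m' => ?_) 3).trans (by omega)
    rw [bind_cost, bind_cost]
    split_ifs <;> simp [target, prefers, ops_cost]

theorem round_val (I : Market n) (k : Man n → ℕ) : (round I k).val = DA.round I k := by
  funext m
  unfold round
  rw [table_val, bind_val, rejected_val]
  by_cases h : DA.Rejected I k m <;> simp [h, DA.round, ops_val]

theorem round_cost_le (I : Market n) (k : Man n → ℕ) :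
    (round I k).cost ≤ 1 + n * (9 * n + 9) := by
  refine (table_cost_le (c := 9 * n + 7) fun m => ?_)
  have := rejected_cost_le I k m
  rw [bind_cost]
  split_ifs <;> rw [ops_cost] <;> omega

theorem iterate_round_val (I : Market n) (t : ℕ) :
    (iterate (round I) t fun _ => 0).val = DA.state I t := by
  induction t with
  | zero => rfl
  | succ t ih => rw [iterate_succ_val, ih, round_val, DA.state]

theorem outcomeRank_val (I : Market n) (L : PrefList n) (w : Woman n) :
    (outcomeRank I L w).val = L.symm (outcome I.men I.women w) := by
  have hk : (iterate (round I) (n ^ 2) (table fun _ : Man n => ops 1 0).val).val =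
      DA.state I (n ^ 2) := iterate_round_val I _
  have ht : ∀ m, DA.target I.men (DA.state I (n ^ 2)) m = some w ↔
      m = outcome I.men I.women w := by
    intro m
    rw [target_eq_some, ← symm_deferredAcceptance, ← Fin.ext_iff, (I.men m).symm.injective.eq_iff]
    exact (deferredAcceptance I).eq_symm_apply.symm
  unfold outcomeRank
  rw [bind_val, bind_val, bind_val, ops_val, hk]
  set r := first _ with hr
  have hval : ∀ m, (do
      let x ← target I.men (DA.state I (n ^ 2)) m
      if x = some w then ops 2 (some (L.symm m : ℕ)) else ops 1 none : Timed (Option ℕ)).val =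
      if m = outcome I.men I.women w then some (L.symm m : ℕ) else none := by
    intro m
    rw [bind_val]
    simp only [target, ops_val, ht]
    split_ifs <;> rfl
  cases h : r.val with
  | none =>
    -- The default value `n` is never returned, since the loop meets the actual partner of `w`.
    have := of_first_eq_none h (outcome I.men I.women w)
    rw [hval, if_pos rfl] at this
    cases this
  | some x =>
    obtain ⟨m, hm⟩ := of_first_eq_some h
    rw [hval] at hm
    split_ifs at hm with he
    rw [← he]
    exact (Option.some.inj hm).symm

/-- A bound on the number of operations of `outcomeRank`. -/
def outcomeRankBound {R : Type} [CommSemiring R] (x : R) : R :=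
  (1 + x * 3) + ((1 + x ^ 2 * (1 + x * (9 * x + 9) + 2)) + ((1 + x * 7) + 1))

theorem outcomeRank_cost_le (I : Market n) (L : PrefList n) (w : Woman n) :
    (outcomeRank I L w).cost ≤ outcomeRankBound n := by
  unfold outcomeRank
  rw [bind_cost, bind_cost, bind_cost, ops_cost]
  refine Nat.add_le_add (table_cost_le fun _ => le_rfl)
    (Nat.add_le_add (iterate_cost_le (round_cost_le I) _ _)
      (Nat.add_le_add (first_cost_le (c := 5) fun m => ?_) le_rfl))
  rw [bind_cost]
  split_ifs <;> simp [target, ops_cost]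

theorem step_val (men : Man n → PrefList n) (Pw : Finset (Woman n)) (p : WomenProfile n) :
    IsManipulationStep men Pw p (step men Pw p).val ∨
      ((¬ ∃ q, IsManipulationStep men Pw p q) ∧ (step men Pw p).val = p) := by
  unfold step
  rw [bind_val, bind_val, bind_val]
  -- The two tables are made opaque and enter below only through `hcur` and `hrk`.
  obtain ⟨current, hcurrent⟩ :
    ∃ f, f = (table fun w => outcomeRank ⟨men, p⟩ (p w) w).val := ⟨_, rfl⟩
  obtain ⟨ranks, hranks⟩ : ∃ f, f = (table fun w => table fun a => table fun b => do
    let L ← promote (p w) a b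
    let q ← replace p w L
    outcomeRank ⟨men, q⟩ (p w) w).val := ⟨_, rfl⟩
  rw [← hcurrent, ← hranks]
  have hcur : ∀ w, current w = (p w).symm (outcome men p w) := fun w => by
    rw [hcurrent]
    exact outcomeRank_val _ _ _
  have hrk : ∀ w a b, ranks w a b = (p w).symm (outcome men
      (Function.update p w (promoted (p w) a b)) w) := fun w a b => by
    rw [hranks]
    exact outcomeRank_val _ _ _
  have hben : ∀ w a b, IsSelfManipulation men (p w) p w (promoted (p w) a b) ↔
      ranks w a b < current w := by
    intro w a b
    rw [hcur, hrk]
    exact Iff.rfl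
  set choice := (first _).val with hchoice
  cases h : choice with
  | none =>
    right
    refine ⟨?_, rfl⟩
    rintro ⟨q, w, hw, L, ⟨hi, hb, ho⟩, -⟩
    obtain ⟨a, b, rfl⟩ := hi.exists_promoted
    have h1 := of_first_eq_none (hchoice.symm.trans h) w
    rw [bind_val, ops_val, decide_eq_true hw, if_pos rfl] at h1
    have h2 := of_first_eq_none (of_first_eq_none h1 a) b
    simp only [bind_val, ops_val, any_val, decide_eq_true_eq] at h2
    split_ifs at h2 with hc
    refine hc ⟨(hben _ _ _).1 hb, ?_⟩
    rintro ⟨a', b', hlt⟩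
    -- A promotion that beats a beneficial one is itself beneficial, so comparing with all
    -- promotions is the same as comparing with the beneficial ones.
    refine ho _ (isPromotion_promoted _ _ _).isInconspicuous
      ((hben w a' b').2 (hlt.trans ((hben _ _ _).1 hb))) ?_
    rw [hrk, hrk] at hlt
    exact hlt
  | some c =>
    left
    obtain ⟨w₀, a₀, b₀⟩ := c
    obtain ⟨w, h1⟩ := of_first_eq_some (hchoice.symm.trans h)
    rw [bind_val, ops_val] at h1
    by_cases hw : w ∈ Pw
    · rw [decide_eq_true hw, if_pos rfl] at h1
      obtain ⟨a, h2⟩ := of_first_eq_some h1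
      obtain ⟨b, h3⟩ := of_first_eq_some h2
      simp only [bind_val, ops_val, any_val, decide_eq_true_eq] at h3
      split_ifs at h3 with hc
      cases h3
      refine ⟨w₀, hw, promoted (p w₀) a₀ b₀, ⟨(isPromotion_promoted _ _ _).isInconspicuous,
        (hben _ _ _).2 hc.1, fun L' hi' _ hp => hc.2 ?_⟩, rfl⟩
      obtain ⟨a', b', rfl⟩ := hi'.exists_promoted
      refine ⟨a', b', ?_⟩
      rw [hrk, hrk]
      exact hp
    · rw [decide_eq_false hw, if_neg (by simp)] at h1
      cases h1

/-- A bound on the number of operations of `step`. -/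
def stepBound {R : Type} [CommSemiring R] (x : R) : R :=
  (1 + x * (outcomeRankBound x + 2)) +
    ((1 + x * (1 + x * (1 + x * (10 * x + 10 + (10 * x ^ 2 + 10 + outcomeRankBound x) + 2) + 2)
        + 2)) +
      ((1 + x * (2 + (1 + x * (1 + x * (3 + (1 + x * (1 + x * (3 + 2) + 2) + 2) + 2) + 2)) + 2)) +
        (11 + 10 * x + (10 * x ^ 2 + 10))))

theorem step_cost_le (men : Man n → PrefList n) (Pw : Finset (Woman n)) (p : WomenProfile n) :
    (step men Pw p).cost ≤ stepBound n := by
  unfold step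
  simp only [bind_cost]
  refine Nat.add_le_add (table_cost_le fun w => outcomeRank_cost_le _ _ _)
    (Nat.add_le_add (table_cost_le fun w => table_cost_le fun a => table_cost_le fun b => ?_)
      (Nat.add_le_add (first_cost_le fun w => ?_) ?_))
  · exact Nat.add_le_add le_rfl (Nat.add_le_add le_rfl (outcomeRank_cost_le _ _ _))
  · rw [bind_cost, ops_cost]
    refine (Nat.add_le_add_right (by omega : 1 ≤ 2) _).trans (Nat.add_le_add_left ?_ 2)
    split_ifs
    · refine first_cost_le fun a => first_cost_le fun b => ?_
      exact Nat.add_le_add le_rfl (Nat.add_le_add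
        (any_cost_le fun a' => any_cost_le fun b' => le_rfl) le_rfl)
    · exact Nat.le_add_right 1 _
  · split
    · rw [ops_cost]
      omega
    · rw [bind_cost, promote, replace, ops_cost, ops_cost]
      omega

theorem run_cost_le (I : Market n) (Pw : Finset (Woman n)) :
    (run I Pw).cost ≤ 1 + n ^ 2 * (stepBound n + 2) :=
  iterate_cost_le (step_cost_le I.men Pw) _ _

/-- The profiles that the algorithm computes form an inconspicuous dynamics. -/
theorem isInconspicuousDynamics_iterate_step (I : Market n) (Pw : Finset (Woman n)) :
    IsInconspicuousDynamics I Pw fun t => (iterate (step I.men Pw) t I.women).val :=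
  ⟨rfl, fun _ => step_val _ _ _⟩

end Algorithm

end WomanManipulation

open WomanManipulation in
theorem mainTheorem3 :
    (∀ (n : ℕ) (I : Market n) (Pw : Finset (Woman n)) (p : ℕ → WomenProfile n),
      IsInconspicuousDynamics I Pw p →
        ∃ T ≤ n ^ 2, (∀ t, T ≤ t → p t = p T) ∧ IsNashEquilibrium I Pw (p T)) ∧
    (∃ q : Polynomial ℕ, ∀ (n : ℕ) (I : Market n) (Pw : Finset (Woman n)),
      (Algorithm.run I Pw).cost ≤ q.eval n ∧
        ∃ p : ℕ → WomenProfile n, IsInconspicuousDynamics I Pw p ∧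
          ∀ t, n ^ 2 ≤ t → p t = (Algorithm.run I Pw).val) := by
  -- The cost bounds are defined over any commutative semiring, so the same expression at `X` is the
  -- required polynomial.
  refine ⟨fun n I Pw p hp => ?_, 1 + .X ^ 2 * (Algorithm.stepBound .X + 2), fun n I Pw => ⟨?_, ?_⟩⟩
  · obtain ⟨T, hT, hfix⟩ := hp.exists_not_isManipulationStep
    exact ⟨T, hT, fun t ht => hp.eq_of_not_isManipulationStep hfix ht, hp.isNashEquilibrium hfix⟩
  · simpa [Algorithm.stepBound, Algorithm.outcomeRankBound] using Algorithm.run_cost_le I Pw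
  · have hp := Algorithm.isInconspicuousDynamics_iterate_step I Pw
    refine ⟨_, hp, fun t ht => ?_⟩
    obtain ⟨T, hT, hfix⟩ := hp.exists_not_isManipulationStep
    exact (hp.eq_of_not_isManipulationStep hfix (hT.trans ht)).trans
      (hp.eq_of_not_isManipulationStep hfix hT).symm
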